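/- Let $(\Omega,d)$ be a Polish metric space. For probability measures $\mu,\nu$ on $\Omega$ let $$W_d(\mu,\nu)=\inf_{\zeta}\int_{\Omega\times\Omega} d(x,y)\,\zeta(dx,dy)\in[0,\infty],$$ where the infimum runs over all couplings $\zeta$ of $\mu$ and $\nu$. Let $K,\tilde K$ be Markov transition kernels on $\Omega$, and let $\pi$ be a stationary probability distribution of $K$. Assume that the eccentricity $E(x)=\int_\Omega d(x,y)\,\pi(dy)$ is finite for every $x\in\Omega$, that for some $0<\alpha\le 1$ $$\sup_{x\ne y\in\Omega}\frac{W_d(K(x,\cdot),K(y,\cdot))}{d(x,y)}\le 1-\alpha,$$ and that for some $0<\delta<\infty$ $$\sup_{x\in\Omega}W_d(\tilde K(x,\cdot),K(x,\cdot))<\delta .$$ Then for every $x\in\Omega$, every Markov chain $\{\tilde X_t\}_{t\ge 0}$ with transition kernel $\tilde K$ and initial point $\tilde X_0=x$, and every integer $T\ge 0$, $$W_d(\mathcal L(\tilde X_T),\pi)\le\frac{\delta}{\alpha}+(1-\alpha)^T E(x),$$ where $\mathcal L(\tilde X_T)$ is the law of $\tilde X_T$. Moreover, every stationary probability distribution $\tilde\pi$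 of $\tilde K$ satisfies $$W_d(\tilde\pi,\pi)\le\frac{\delta}{\alpha}.$$ -/

import Mathlib

open MeasureTheory ProbabilityTheory
open scoped ENNReal

namespace MarkovPerturbation

/-- The set of couplings of `μ` and `ν`: measures on the product space with marginals
`μ` and `ν`. -/
def couplings {Ω : Type*} [MeasurableSpace Ω] (μ ν : Measure Ω) : Set (Measure (Ω × Ω)) :=
  {ζ | ζ.fst = μ ∧ ζ.snd = ν}

/-- The Wasserstein distance `W_d(μ, ν)`, the infimum over all couplings `ζ` of `μ` and `ν`
of `∫ d(x, y) ζ(dx, dy)`, as an element of `[0, ∞]`. -/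
noncomputable def wasserstein {Ω : Type*} [MetricSpace Ω] [MeasurableSpace Ω]
    (μ ν : Measure Ω) : ℝ≥0∞ :=
  ⨅ ζ ∈ couplings μ ν, ∫⁻ p, edist p.1 p.2 ∂ζ

/-- The eccentricity `E(x) = ∫ d(x, y) π(dy)`, as an element of `[0, ∞]`. -/
noncomputable def eccentricity {Ω : Type*} [MetricSpace Ω] [MeasurableSpace Ω]
    (π : Measure Ω) (x : Ω) : ℝ≥0∞ :=
  ∫⁻ y, edist x y ∂π

/-- The σ-algebra generated by `X 0, …, X t`. -/
@[reducible]
def past {Ω S : Type*} [MeasurableSpace Ω] (X : ℕ → S → Ω) (t : ℕ) : MeasurableSpace S :=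
  ⨆ s : Fin (t + 1), MeasurableSpace.comap (X s) inferInstance

/-- `X` is a (time-homogeneous) Markov chain on the probability space `(S, P)` with transition
kernel `K` and initial point `x`: almost surely `X 0 = x`, and the conditional probability of
`X (t + 1) ∈ A` given `X 0, …, X t` is `K (X t) A`. -/
structure IsMarkovChain {Ω S : Type*} [MeasurableSpace Ω] [MeasurableSpace S]
    (K : Kernel Ω Ω) (x : Ω) (P : Measure S) (X : ℕ → S → Ω) : Prop where
  measurable : ∀ t, Measurable (X t)
  initial : ∀ᵐ ω ∂P, X 0 ω = x
  transition : ∀ (t : ℕ) (A : Set Ω), MeasurableSet A →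
    P⟦X (t + 1) ⁻¹' A | past X t⟧ =ᵐ[P] fun ω => (K (X t ω)).real A

end MarkovPerturbation

/-! Distances are handled through their dual form: `LipschitzClose μ ν b` tests against bounded
Lipschitz functions. A kernel that contracts `W_d` by `β = 1 - α` maps `c`-Lipschitz functions to
`cβ`-Lipschitz ones, so one step turns a bound `b` into `βb + δ` (`LipschitzClose.bind`), and no
measurable choice of couplings of `K x` and `K y` is needed. Iterating from the Dirac mass at `x`,
at distance at most `E(x)` from `π`, gives `δ/α + β^n E(x)`. A stationary law of the perturbed
kernel is an average of its `n`-step laws, and `n → ∞` removes the second term. The return to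
couplings is Kantorovich–Rubinstein duality (`LipschitzClose.wasserstein_le`): discretise both
measures by a simple function, solve the finite problem by Hahn–Banach, and spread the finite plan
over the cells. -/

open scoped NNReal Topology

namespace MarkovPerturbation

/-! ### Duality on a finite space -/

section FiniteDuality

/-- **Kantorovich duality on a finite space.** If all functions that are Lipschitz for a cost `c`
satisfying the triangle inequality have `p`- and `q`-means differing by at most the Lipschitz
constant times `b`, then there is a coupling of `p` and `q` of cost at most `b`. -/
theorem exists_coupling_of_fintype {ι : Type*} [Fintype ι] (c : ι → ι → ℝ)
    (hself : ∀ i, c i i = 0) (htri : ∀ i j k, c i k ≤ c i j + c j k) (p q : ι → ℝ)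
    (hp : ∀ i, 0 ≤ p i) (hp1 : ∑ i, p i = 1) (hq : ∀ i, 0 ≤ q i) (b : ℝ)
    (h : ∀ (w : ℝ) (φ : ι → ℝ), 0 ≤ w → (∀ i j, φ i ≤ φ j + w * c i j) →
      ∑ i, p i * φ i ≤ ∑ i, q i * φ i + w * b) :
    ∃ ζ : ι × ι → ℝ, (∀ a, 0 ≤ ζ a) ∧ (∀ i, ∑ j, ζ (i, j) = p i) ∧
      (∀ j, ∑ i, ζ (i, j) = q j) ∧ ∑ a, ζ a * c a.1 a.2 ≤ b := by
  classical
  -- `T` records both marginals and the cost of a plan. Without a good plan, the compact convex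
  -- image of the simplex misses the closed convex set `{p} × {q} × (-∞, b]`, and the two can be
  -- separated.
  let T : (ι × ι → ℝ) →ₗ[ℝ] (ι → ℝ) × (ι → ℝ) × ℝ :=
    LinearMap.prod (LinearMap.pi fun i => ∑ j, LinearMap.proj (i, j))
      (LinearMap.prod (LinearMap.pi fun j => ∑ i, LinearMap.proj (i, j))
        (∑ a : ι × ι, c a.1 a.2 • LinearMap.proj a))
  have hT : ∀ ζ, T ζ = (fun i => ∑ j, ζ (i, j), fun j => ∑ i, ζ (i, j),
      ∑ a, ζ a * c a.1 a.2) := by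
    intro ζ
    simp only [T, LinearMap.prod_apply, Function.prod_apply, Prod.mk.injEq]
    refine ⟨?_, ?_, ?_⟩
    · ext i; simp
    · ext i; simp
    · simp [mul_comm]
  by_contra hcon
  push Not at hcon
  have hdisj : Disjoint (({p} : Set (ι → ℝ)) ×ˢ ({q} : Set (ι → ℝ)) ×ˢ Set.Iic b)
      (T '' stdSimplex ℝ (ι × ι)) := by
    rw [Set.disjoint_left]
    rintro ⟨x, y, r⟩ ⟨hx, hy, hr⟩ ⟨ζ, hζ, hζT⟩
    simp only [Set.mem_singleton_iff, Set.mem_Iic] at hx hy hr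
    rw [hT] at hζT
    simp only [Prod.mk.injEq] at hζT
    obtain ⟨h1, h2, h3⟩ := hζT
    have := hcon ζ hζ.1 (fun i => by rw [← hx, ← h1]) (fun j => by rw [← hy, ← h2])
    linarith
  obtain ⟨f, U, V, hfU, hUV, hfV⟩ := geometric_hahn_banach_closed_compact
    ((convex_singleton p).prod ((convex_singleton q).prod (convex_Iic b)))
    (isClosed_singleton.prod (isClosed_singleton.prod isClosed_Iic))
    ((convex_stdSimplex ℝ (ι × ι)).linear_image T)
    ((isCompact_stdSimplex ℝ (ι × ι)).image T.continuous_of_finiteDimensional) hdisj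
  set u : ι → ℝ := fun i => f (Pi.single i 1, 0, 0) with hu
  set v : ι → ℝ := fun i => f (0, Pi.single i 1, 0) with hv
  set w : ℝ := f (0, 0, 1) with hw
  have hdec : ∀ x y r, f (x, y, r) = ∑ i, x i * u i + ∑ i, y i * v i + r * w := by
    intro x y r
    have hsum : ∀ (g : (ι → ℝ) →ₗ[ℝ] ℝ) (x : ι → ℝ), g x = ∑ i, x i * g (Pi.single i 1) := by
      intro g x
      rw [LinearMap.pi_apply_eq_sum_univ g x]
      refine Finset.sum_congr rfl fun i _ => ?_
      rw [smul_eq_mul]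
      congr 2
      ext j
      rw [Pi.single_apply]
      exact if_congr eq_comm rfl rfl
    have e1 : f (x, 0, 0) = ∑ i, x i * u i :=
      hsum (f.toLinearMap ∘ₗ LinearMap.inl ℝ _ _) x
    have e2 : f (0, y, 0) = ∑ i, y i * v i :=
      hsum (f.toLinearMap ∘ₗ LinearMap.inr ℝ _ _ ∘ₗ LinearMap.inl ℝ _ _) y
    have e3 : f (0, 0, r) = r * w := by
      rw [hw, ← smul_eq_mul, ← map_smul]; simp
    rw [← e1, ← e2, ← e3, ← map_add, ← map_add]; simp
  -- If `w < 0`, letting the cost coordinate tend to `-∞` makes `f` unbounded above on the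
  -- half-line, against `hfU`.
  have hw0 : 0 ≤ w := by
    by_contra! hneg
    have h1 := hfU (p, q, min b ((U - (∑ i, p i * u i + ∑ i, q i * v i)) / w)) (by simp)
    rw [hdec] at h1
    have h2 : (U - (∑ i, p i * u i + ∑ i, q i * v i)) / w * w
        ≤ min b ((U - (∑ i, p i * u i + ∑ i, q i * v i)) / w) * w :=
      mul_le_mul_of_nonpos_right (min_le_right _ _) hneg.le
    rw [div_mul_cancel₀ _ hneg.ne] at h2
    linarith
  have hvert : ∀ i j, V < u i + v j + w * c i j := by
    intro i j
    have := hfV _ ⟨_, single_mem_stdSimplex ℝ (i, j), rfl⟩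
    rw [hT, hdec] at this
    have hc : ∑ a, (Pi.single (i, j) 1 : ι × ι → ℝ) a * c a.1 a.2 = c i j := by
      rw [Finset.sum_eq_single (i, j)] <;> simp +contextual
    rw [hc] at this
    simpa [Pi.single_apply, Prod.ext_iff, ite_and, mul_comm] using this
  have hpq := hfU (p, q, b) (by simp)
  rw [hdec] at hpq
  have hne : (Finset.univ : Finset ι).Nonempty := by
    rw [Finset.univ_nonempty_iff]
    by_contra hemp
    rw [not_nonempty_iff] at hemp
    simp at hp1
  -- The `c`-transform of `v`: it is Lipschitz for `w * c`, lies below `v`, and satisfies `V ≤ u +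
  -- φ`. Testing `h` on it contradicts `U < V`.
  let φ : ι → ℝ := fun i => Finset.univ.inf' hne fun j => v j + w * c i j
  have hφle : ∀ i j, φ i ≤ v j + w * c i j := fun i j =>
    Finset.inf'_le (fun j => v j + w * c i j) (Finset.mem_univ j)
  have hφ : ∀ i j, φ i ≤ φ j + w * c i j := by
    intro i j
    obtain ⟨k, -, hk⟩ := Finset.exists_mem_eq_inf' hne fun k => v k + w * c j k
    have h1 := hφle i k
    have h2 := mul_le_mul_of_nonneg_left (htri i j k) hw0
    have h3 : φ j = v k + w * c j k := hk
    linarith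
  have huφ : ∀ i, V ≤ u i + φ i := by
    intro i
    obtain ⟨k, -, hk⟩ := Finset.exists_mem_eq_inf' hne fun k => v k + w * c i k
    have h3 : φ i = v k + w * c i k := hk
    linarith [hvert i k]
  have s1 : V ≤ ∑ i, p i * u i + ∑ i, p i * φ i := by
    calc V = ∑ i, p i * V := by rw [← Finset.sum_mul, hp1, one_mul]
      _ ≤ ∑ i, p i * (u i + φ i) :=
        Finset.sum_le_sum fun i _ => mul_le_mul_of_nonneg_left (huφ i) (hp i)
      _ = _ := by simp [mul_add, Finset.sum_add_distrib]
  have s2 : ∑ i, q i * φ i ≤ ∑ i, q i * v i := by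
    refine Finset.sum_le_sum fun i _ => mul_le_mul_of_nonneg_left ?_ (hq i)
    simpa [hself] using hφle i i
  have s3 := h w φ hw0 hφ
  linarith

end FiniteDuality

/-! ### Bounded functions, finite-valued maps and null cells -/

theorem integrable_of_abs_le {Ω : Type*} [MeasurableSpace Ω] {μ : Measure Ω} [IsFiniteMeasure μ] {f : Ω → ℝ}
    (hf : Measurable f) (hM : ∃ M, ∀ x, |f x| ≤ M) : Integrable f μ := by
  obtain ⟨M, hM⟩ := hM
  exact Integrable.of_bound hf.aestronglyMeasurable M (ae_of_all _ hM)

theorem integral_comp_eq_sum {Ω ι : Type*} [MeasurableSpace Ω] [Fintype ι] [MeasurableSpace ι]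
    [MeasurableSingletonClass ι] {μ : Measure Ω} [IsFiniteMeasure μ] {G : Ω → ι}
    (hG : Measurable G) (φ : ι → ℝ) :
    ∫ x, φ (G x) ∂μ = ∑ i, μ.real (G ⁻¹' {i}) * φ i := by
  rw [← integral_map hG.aemeasurable (measurable_of_finite φ).aestronglyMeasurable,
    integral_fintype]
  · refine Finset.sum_congr rfl fun i _ => ?_
    rw [map_measureReal_apply hG (measurableSet_singleton i), smul_eq_mul]
  · exact Integrable.of_finite

/-- A Lipschitz function on a subset that is finite extends to a bounded Lipschitz function. -/
theorem exists_bounded_lipschitz_extension {Ω : Type*} [MetricSpace Ω] {s : Set Ω} [Finite s] {c : ℝ≥0} {φ : s → ℝ}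
    (hφ : LipschitzWith c φ) :
    ∃ f : Ω → ℝ, LipschitzWith c f ∧ (∃ M, ∀ x, |f x| ≤ M) ∧ ∀ i : s, f i = φ i := by
  classical
  obtain ⟨M, hM⟩ : ∃ M, ∀ i, |φ i| ≤ M := by
    obtain ⟨M, hM⟩ := (Set.finite_range fun i => |φ i|).bddAbove
    exact ⟨M, fun i => hM ⟨i, rfl⟩⟩
  let ψ : Ω → ℝ := fun x => if h : x ∈ s then φ ⟨x, h⟩ else 0
  have hψ : LipschitzOnWith c ψ s := by
    intro x hx y hy
    simpa [ψ, hx, hy] using hφ ⟨x, hx⟩ ⟨y, hy⟩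
  obtain ⟨g, hg, hgs⟩ := hψ.extend_real
  refine ⟨fun x => max (min (g x) |M|) (-|M|), (hg.min_const _).max_const _,
    ⟨|M|, fun x => ?_⟩, fun i => ?_⟩
  · rw [abs_le]
    exact ⟨le_max_right _ _, max_le (min_le_right _ _) (by linarith [abs_nonneg M])⟩
  · have h1 : g i = φ i := by
      rw [← hgs i.2]; simp [ψ]
    have h2 := abs_le.1 ((hM i).trans (le_abs_self M))
    simp only [h1, min_eq_left h2.2, max_eq_left h2.1]

/-- Conditioning on a null cell yields the zero measure, not a probability measure. The block
coupling is unharmed, since such a cell carries no weight in `ζ`. -/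
theorem measure_preimage_fst_ne_zero {Ω ι : Type*} [MeasurableSpace Ω] [Fintype ι] {μ : Measure Ω} {G : Ω → ι}
    {ζ : ι × ι → ℝ} (h0 : ∀ a, 0 ≤ ζ a)
    (h1 : ∀ i, ∑ j, ζ (i, j) = μ.real (G ⁻¹' {i})) {a : ι × ι} (ha : ζ a ≠ 0) :
    μ (G ⁻¹' {a.1}) ≠ 0 := by
  intro h
  have h2 := h1 a.1
  rw [measureReal_def, h, ENNReal.toReal_zero,
    Finset.sum_eq_zero_iff_of_nonneg fun j _ => h0 _] at h2
  exact ha (h2 a.2 (Finset.mem_univ _))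

theorem measure_preimage_snd_ne_zero {Ω ι : Type*} [MeasurableSpace Ω] [Fintype ι] {ν : Measure Ω} {G : Ω → ι}
    {ζ : ι × ι → ℝ} (h0 : ∀ a, 0 ≤ ζ a)
    (h2 : ∀ j, ∑ i, ζ (i, j) = ν.real (G ⁻¹' {j})) {a : ι × ι} (ha : ζ a ≠ 0) :
    ν (G ⁻¹' {a.2}) ≠ 0 := by
  intro h
  have h3 := h2 a.2
  rw [measureReal_def, h, ENNReal.toReal_zero,
    Finset.sum_eq_zero_iff_of_nonneg fun j _ => h0 _] at h3
  exact ha (h3 a.1 (Finset.mem_univ _))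

/-! ### Closeness tested on Lipschitz functions -/

section Lipschitz

variable {Ω : Type*} [MetricSpace Ω] [MeasurableSpace Ω] [BorelSpace Ω]

/-- The integrals of bounded Lipschitz functions against `μ` exceed those against `ν` by at most
the Lipschitz constant times `b`. -/
def LipschitzClose (μ ν : Measure Ω) (b : ℝ) : Prop :=
  ∀ (c : ℝ≥0) (f : Ω → ℝ), LipschitzWith c f → (∃ M, ∀ x, |f x| ≤ M) →
    ∫ x, f x ∂μ ≤ ∫ x, f x ∂ν + c * b

/-- The truncations `min (dist x y) n` are admissible tests; monotone convergence in `n` does the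
rest. -/
theorem LipschitzClose.lintegral_edist_ne_top {μ ν : Measure Ω} [IsFiniteMeasure μ]
    [IsFiniteMeasure ν] {b : ℝ} (h : LipschitzClose μ ν b) {x : Ω}
    (hν : ∫⁻ y, edist x y ∂ν ≠ ∞) : ∫⁻ y, edist x y ∂μ ≠ ∞ := by
  have hm : Measurable fun y => edist x y := measurable_edist_right
  have hL : ∀ n : ℕ, LipschitzWith 1 fun y => min (dist x y) n := fun n =>
    (LipschitzWith.dist_right x).min_const _
  have hM : ∀ n : ℕ, ∀ y, |min (dist x y) n| ≤ n := fun n y => by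
    rw [abs_of_nonneg (by positivity)]; exact min_le_right _ _
  have iD : Integrable (fun y => dist x y) ν := by
    simp_rw [dist_edist]
    exact integrable_toReal_of_lintegral_ne_top hm.aemeasurable hν
  have hbd : ∀ n : ℕ, ∫⁻ y, ENNReal.ofReal (min (dist x y) n) ∂μ ≤
      ENNReal.ofReal (∫ y, dist x y ∂ν + b) := by
    intro n
    rw [← ofReal_integral_eq_lintegral_ofReal
      (integrable_of_abs_le (hL n).continuous.measurable ⟨n, hM n⟩)
      (ae_of_all _ fun y => by positivity)]
    refine ENNReal.ofReal_le_ofReal ?_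
    have h1 := h 1 _ (hL n) ⟨n, hM n⟩
    have h2 : ∫ y, min (dist x y) n ∂ν ≤ ∫ y, dist x y ∂ν :=
      integral_mono (integrable_of_abs_le (hL n).continuous.measurable ⟨n, hM n⟩) iD
        fun y => min_le_left _ _
    simp only [NNReal.coe_one, one_mul] at h1
    linarith
  have hlim : Filter.Tendsto (fun n : ℕ => ∫⁻ y, ENNReal.ofReal (min (dist x y) n) ∂μ)
      Filter.atTop (𝓝 (∫⁻ y, edist x y ∂μ)) := by
    refine lintegral_tendsto_of_tendsto_of_monotone
      (fun n => ((hL n).continuous.measurable.ennreal_ofReal).aemeasurable)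
      (ae_of_all _ fun y m n hmn => ?_) (ae_of_all _ fun y => ?_)
    · dsimp only
      gcongr
    · refine tendsto_const_nhds.congr' ?_
      obtain ⟨N, hN⟩ := exists_nat_ge (dist x y)
      filter_upwards [Filter.eventually_ge_atTop N] with n hn
      rw [min_eq_left (hN.trans (by exact_mod_cast hn)), edist_dist]
  exact ne_top_of_le_ne_top ENNReal.ofReal_ne_top (le_of_tendsto' hlim hbd)

variable [SecondCountableTopology Ω]

theorem integral_comp_le_of_lintegral_edist_le {S : Type*} [MeasurableSpace S] {P : Measure S}
    [IsFiniteMeasure P] {X Y : S → Ω} (hX : Measurable X) (hY : Measurable Y) {e : ℝ}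
    (he : 0 ≤ e) (h : ∫⁻ s, edist (X s) (Y s) ∂P ≤ ENNReal.ofReal e) {c : ℝ≥0} {f : Ω → ℝ}
    (hf : LipschitzWith c f) (hM : ∃ M, ∀ x, |f x| ≤ M) :
    ∫ s, f (X s) ∂P ≤ ∫ s, f (Y s) ∂P + c * e := by
  obtain ⟨M, hM⟩ := hM
  have hfm : Measurable f := hf.continuous.measurable
  have iX : Integrable (fun s => f (X s)) P :=
    Integrable.of_bound (hfm.comp hX).aestronglyMeasurable M (ae_of_all _ fun s => hM _)
  have iY : Integrable (fun s => f (Y s)) P :=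
    Integrable.of_bound (hfm.comp hY).aestronglyMeasurable M (ae_of_all _ fun s => hM _)
  have hm : Measurable fun s => edist (X s) (Y s) := hX.edist hY
  have hfin : ∫⁻ s, edist (X s) (Y s) ∂P ≠ ∞ := ne_top_of_le_ne_top ENNReal.ofReal_ne_top h
  have hd : ∫ s, dist (X s) (Y s) ∂P ≤ e := by
    simp_rw [dist_edist]
    rw [integral_toReal hm.aemeasurable (ae_of_all _ fun s => edist_lt_top _ _)]
    exact ENNReal.toReal_le_of_le_ofReal he h
  have iD : Integrable (fun s => dist (X s) (Y s)) P := by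
    simp_rw [dist_edist]
    exact integrable_toReal_of_lintegral_ne_top hm.aemeasurable hfin
  calc ∫ s, f (X s) ∂P ≤ ∫ s, (f (Y s) + c * dist (X s) (Y s)) ∂P := by
        refine integral_mono iX (iY.add (iD.const_mul _)) fun s => ?_
        have := (le_abs_self _).trans (hf.dist_le_mul (X s) (Y s))
        dsimp only
        linarith
    _ = ∫ s, f (Y s) ∂P + c * ∫ s, dist (X s) (Y s) ∂P := by
        rw [integral_add iY (iD.const_mul _), integral_const_mul]
    _ ≤ _ := by gcongr

theorem LipschitzClose.of_coupling {μ ν : Measure Ω} [IsFiniteMeasure μ] {ζ : Measure (Ω × Ω)}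
    (hζ : ζ ∈ couplings μ ν) {b : ℝ} (hb : 0 ≤ b)
    (h : ∫⁻ p, edist p.1 p.2 ∂ζ ≤ ENNReal.ofReal b) : LipschitzClose μ ν b := by
  intro c f hf hM
  obtain ⟨rfl, rfl⟩ := hζ
  have : IsFiniteMeasure ζ := ⟨by
    rw [← Measure.fst_univ]; exact measure_lt_top _ _⟩
  have hfm := hf.continuous.measurable.stronglyMeasurable
  rw [Measure.fst, Measure.snd, integral_map measurable_fst.aemeasurable hfm.aestronglyMeasurable,
    integral_map measurable_snd.aemeasurable hfm.aestronglyMeasurable]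
  exact integral_comp_le_of_lintegral_edist_le measurable_fst measurable_snd hb h hf hM

theorem LipschitzClose.of_wasserstein_le {μ ν : Measure Ω} [IsFiniteMeasure μ] {b : ℝ}
    (hb : 0 ≤ b) (h : wasserstein μ ν ≤ ENNReal.ofReal b) : LipschitzClose μ ν b := by
  -- The slack `ε` allows a near-optimal coupling, so attainment of the infimum is not needed.
  have key : ∀ ε > 0, LipschitzClose μ ν (b + ε) := by
    intro ε hε
    have hlt : wasserstein μ ν < ENNReal.ofReal (b + ε) :=
      h.trans_lt (by rw [ENNReal.ofReal_lt_ofReal_iff (by linarith)]; linarith)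
    simp only [wasserstein, iInf_lt_iff] at hlt
    obtain ⟨ζ, hζ, hlt⟩ := hlt
    exact .of_coupling hζ (by linarith) hlt.le
  intro c f hf hM
  have hlim : Filter.Tendsto (fun ε : ℝ => ∫ x, f x ∂ν + c * (b + ε)) (𝓝[>] 0)
      (𝓝 (∫ x, f x ∂ν + c * (b + 0))) :=
    (Continuous.tendsto (by fun_prop) 0).mono_left nhdsWithin_le_nhds
  rw [add_zero] at hlim
  exact ge_of_tendsto hlim (by filter_upwards [self_mem_nhdsWithin] with ε hε using key ε hε c f hf hM)

theorem exists_simpleFunc_lintegral_edist_le {μ : Measure Ω} {x₀ : Ω}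
    (hμ : ∫⁻ y, edist x₀ y ∂μ ≠ ∞) {ε : ℝ≥0∞} (hε : 0 < ε) :
    ∃ g : SimpleFunc Ω Ω, ∫⁻ x, edist (g x) x ∂μ ≤ ε := by
  let G : ℕ → SimpleFunc Ω Ω :=
    fun n => SimpleFunc.approxOn id measurable_id Set.univ x₀ (Set.mem_univ x₀) n
  have hlim : Filter.Tendsto (fun n => ∫⁻ x, edist (G n x) x ∂μ) Filter.atTop
      (𝓝 (∫⁻ _, 0 ∂μ)) := by
    refine tendsto_lintegral_of_dominated_convergence (fun y => edist x₀ y)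
      (fun n => (G n).measurable.edist measurable_id)
      (fun n => ae_of_all _ fun y => ?_) hμ (ae_of_all _ fun y => ?_)
    · exact SimpleFunc.edist_approxOn_le measurable_id (Set.mem_univ x₀) y n
    · rw [← tendsto_iff_edist_tendsto_0]
      exact SimpleFunc.tendsto_approxOn measurable_id (Set.mem_univ x₀) (by simp)
  rw [lintegral_zero] at hlim
  obtain ⟨n, hn⟩ := (hlim.eventually_le_const hε).exists
  exact ⟨G n, hn⟩

end Lipschitz

/-! ### Lifting a finite plan to a coupling -/

section Gluing

variable {Ω ι : Type*} [MeasurableSpace Ω] [Fintype ι] [MeasurableSpace ι]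
  [MeasurableSingletonClass ι]

/-- The measure on `Ω × Ω` whose blocks `{G = i} × {G = j}` carry mass `ζ (i, j)`, distributed as
the product of the conditional measures. -/
noncomputable def blockCoupling (μ ν : Measure Ω) (G : Ω → ι) (ζ : ι × ι → ℝ) :
    Measure (Ω × Ω) :=
  ∑ a : ι × ι, ENNReal.ofReal (ζ a) • (μ[|G ⁻¹' {a.1}]).prod (ν[|G ⁻¹' {a.2}])

variable {μ ν : Measure Ω} [IsProbabilityMeasure μ] [IsProbabilityMeasure ν] {G : Ω → ι}
  {ζ : ι × ι → ℝ}

theorem blockCoupling_mem_couplings (hG : Measurable G) (h0 : ∀ a, 0 ≤ ζ a)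
    (h1 : ∀ i, ∑ j, ζ (i, j) = μ.real (G ⁻¹' {i}))
    (h2 : ∀ j, ∑ i, ζ (i, j) = ν.real (G ⁻¹' {j})) :
    blockCoupling μ ν G ζ ∈ couplings μ ν := by
  constructor
  · refine Measure.ext fun A hA => ?_
    rw [Measure.fst_apply hA, blockCoupling, Measure.finsetSum_apply]
    have hterm : ∀ a : ι × ι, (ENNReal.ofReal (ζ a) •
        (μ[|G ⁻¹' {a.1}]).prod (ν[|G ⁻¹' {a.2}])) (Prod.fst ⁻¹' A) =
        ENNReal.ofReal (ζ a) * μ[|G ⁻¹' {a.1}] A := by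
      intro a
      rcases eq_or_ne (ζ a) 0 with ha | ha
      · simp [ha]
      have := cond_isProbabilityMeasure (measure_preimage_snd_ne_zero h0 h2 ha)
      rw [Measure.smul_apply, smul_eq_mul, ← Set.prod_univ, Measure.prod_prod, measure_univ, mul_one]
    simp_rw [hterm]
    rw [Fintype.sum_prod_type]
    simp_rw [← Finset.sum_mul]
    conv_rhs => rw [← sum_meas_smul_cond_fiber hG μ, Measure.finsetSum_apply]
    refine Finset.sum_congr rfl fun i _ => ?_
    rw [← ENNReal.ofReal_sum_of_nonneg fun j _ => h0 _, h1, ofReal_measureReal]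
    simp
  · refine Measure.ext fun A hA => ?_
    rw [Measure.snd_apply hA, blockCoupling, Measure.finsetSum_apply]
    have hterm : ∀ a : ι × ι, (ENNReal.ofReal (ζ a) •
        (μ[|G ⁻¹' {a.1}]).prod (ν[|G ⁻¹' {a.2}])) (Prod.snd ⁻¹' A) =
        ENNReal.ofReal (ζ a) * ν[|G ⁻¹' {a.2}] A := by
      intro a
      rcases eq_or_ne (ζ a) 0 with ha | ha
      · simp [ha]
      have := cond_isProbabilityMeasure (measure_preimage_fst_ne_zero h0 h1 ha)
      rw [Measure.smul_apply, smul_eq_mul, ← Set.univ_prod, Measure.prod_prod, measure_univ, one_mul]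
    simp_rw [hterm]
    rw [Fintype.sum_prod_type_right]
    simp_rw [← Finset.sum_mul]
    conv_rhs => rw [← sum_meas_smul_cond_fiber hG ν, Measure.finsetSum_apply]
    refine Finset.sum_congr rfl fun i _ => ?_
    rw [← ENNReal.ofReal_sum_of_nonneg fun j _ => h0 _, h2, ofReal_measureReal]
    simp

theorem lintegral_blockCoupling_comp_le (hG : Measurable G) (h0 : ∀ a, 0 ≤ ζ a)
    (h1 : ∀ i, ∑ j, ζ (i, j) = μ.real (G ⁻¹' {i}))
    (h2 : ∀ j, ∑ i, ζ (i, j) = ν.real (G ⁻¹' {j})) (F : ι → ι → ℝ≥0∞) :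
    ∫⁻ p, F (G p.1) (G p.2) ∂(blockCoupling μ ν G ζ) ≤
      ∑ a, ENNReal.ofReal (ζ a) * F a.1 a.2 := by
  rw [blockCoupling, lintegral_finsetSum_measure]
  refine Finset.sum_le_sum fun a _ => ?_
  rw [lintegral_smul_measure, smul_eq_mul]
  rcases eq_or_ne (ζ a) 0 with ha | ha
  · simp [ha]
  have i1 := cond_isProbabilityMeasure (measure_preimage_fst_ne_zero h0 h1 ha)
  have i2 := cond_isProbabilityMeasure (measure_preimage_snd_ne_zero h0 h2 ha)
  have e1 : ∀ᵐ x ∂μ[|G ⁻¹' {a.1}], G x = a.1 := ae_cond_mem (hG (measurableSet_singleton _))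
  have e2 : ∀ᵐ x ∂ν[|G ⁻¹' {a.2}], G x = a.2 := ae_cond_mem (hG (measurableSet_singleton _))
  gcongr
  refine le_of_eq ?_
  calc ∫⁻ p, F (G p.1) (G p.2) ∂((μ[|G ⁻¹' {a.1}]).prod (ν[|G ⁻¹' {a.2}]))
      = ∫⁻ _, F a.1 a.2 ∂((μ[|G ⁻¹' {a.1}]).prod (ν[|G ⁻¹' {a.2}])) := by
        refine lintegral_congr_ae ?_
        filter_upwards [Measure.quasiMeasurePreserving_fst.ae e1,
          Measure.quasiMeasurePreserving_snd.ae e2] with p hp1 hp2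
        rw [hp1, hp2]
    _ = F a.1 a.2 := by simp

end Gluing

/-! ### Duality on a separable metric space -/

section Duality

variable {Ω : Type*} [MetricSpace Ω] [SecondCountableTopology Ω] [MeasurableSpace Ω] [BorelSpace Ω]

/-- **Kantorovich–Rubinstein duality**, in the nontrivial direction. -/
theorem LipschitzClose.wasserstein_le {μ ν : Measure Ω} [IsProbabilityMeasure μ]
    [IsProbabilityMeasure ν] {b : ℝ} (h : LipschitzClose μ ν b) {x₀ : Ω}
    (hν : ∫⁻ y, edist x₀ y ∂ν ≠ ∞) (hb : 0 ≤ b) : wasserstein μ ν ≤ ENNReal.ofReal b := by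
  have hμ := h.lintegral_edist_ne_top hν
  have key : ∀ ε > 0, wasserstein μ ν ≤ ENNReal.ofReal (b + 4 * ε) := by
    intro ε hε
    -- Approximating for `μ + ν` yields one `g` that serves both measures.
    obtain ⟨g, hg⟩ := exists_simpleFunc_lintegral_edist_le (μ := μ + ν) (x₀ := x₀)
      (by rw [lintegral_add_measure]; exact ENNReal.add_ne_top.2 ⟨hμ, hν⟩)
      (ENNReal.ofReal_pos.2 hε)
    rw [lintegral_add_measure] at hg
    have hgμ : ∫⁻ x, edist (g x) x ∂μ ≤ ENNReal.ofReal ε := le_self_add.trans hg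
    have hgν : ∫⁻ x, edist (g x) x ∂ν ≤ ENNReal.ofReal ε := le_add_self.trans hg
    have hgμ' : ∫⁻ x, edist x (g x) ∂μ ≤ ENNReal.ofReal ε := by simpa only [edist_comm] using hgμ
    have hgν' : ∫⁻ x, edist x (g x) ∂ν ≤ ENNReal.ofReal ε := by simpa only [edist_comm] using hgν
    let s : Set Ω := Set.range g
    have : Finite s := g.finite_range
    have : Fintype s := Fintype.ofFinite s
    let G : Ω → s := fun x => ⟨g x, Set.mem_range_self x⟩
    have hG : Measurable G := g.measurable.subtype_mk
    have hsum : ∀ (ρ : Measure Ω) [IsProbabilityMeasure ρ], ∑ i, ρ.real (G ⁻¹' {i}) = 1 := by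
      intro ρ _
      have := integral_comp_eq_sum (μ := ρ) hG fun _ => 1
      simpa using this.symm
    -- Discretising each measure costs `ε`, hence `b + 2 * ε` here; returning from `g x` to `x` in
    -- both coordinates costs another `2 * ε`.
    obtain ⟨ζ, h0, h1, h2, h3⟩ := exists_coupling_of_fintype (fun i j : s => dist i j)
      dist_self dist_triangle (fun i => μ.real (G ⁻¹' {i})) (fun i => ν.real (G ⁻¹' {i}))
      (fun i => measureReal_nonneg) (hsum μ) (fun i => measureReal_nonneg) (b + 2 * ε) (by
        intro w φ hw hφ
        obtain ⟨f, hf, hM, hfφ⟩ := exists_bounded_lipschitz_extension (c := ⟨w, hw⟩) (φ := φ)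
          (LipschitzWith.of_le_add_mul _ hφ)
        have e : ∀ x, φ (G x) = f (g x) := fun x => (hfφ (G x)).symm
        rw [← integral_comp_eq_sum hG, ← integral_comp_eq_sum hG]
        simp_rw [e]
        have k1 := integral_comp_le_of_lintegral_edist_le g.measurable measurable_id hε.le hgμ hf hM
        have k2 := integral_comp_le_of_lintegral_edist_le measurable_id g.measurable hε.le hgν'
          hf hM
        have k3 := h _ f hf hM
        change _ ≤ _ + w * ε at k1
        change _ ≤ _ + w * ε at k2
        change _ ≤ _ + w * b at k3
        simp only [id] at k1 k2
        linarith)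
    have hc := blockCoupling_mem_couplings hG h0 h1 h2
    refine (iInf₂_le _ hc).trans ?_
    set Z := blockCoupling μ ν G ζ
    have hgm := g.measurable
    have m1 : Measurable fun p : Ω × Ω => edist p.1 (g p.1) :=
      measurable_fst.edist (hgm.comp measurable_fst)
    have m2 : Measurable fun p : Ω × Ω => edist (g p.2) p.2 :=
      (hgm.comp measurable_snd).edist measurable_snd
    calc ∫⁻ p, edist p.1 p.2 ∂Z
        ≤ ∫⁻ p, (edist p.1 (g p.1) + edist (g p.1) (g p.2)) + edist (g p.2) p.2 ∂Z :=
          lintegral_mono fun p => edist_triangle4 _ _ _ _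
      _ = ∫⁻ p, edist p.1 (g p.1) ∂Z + ∫⁻ p, edist (g p.1) (g p.2) ∂Z
            + ∫⁻ p, edist (g p.2) p.2 ∂Z := by
          rw [lintegral_add_right _ m2, lintegral_add_left m1]
      _ ≤ ENNReal.ofReal ε + ENNReal.ofReal (b + 2 * ε) + ENNReal.ofReal ε := by
          gcongr
          · refine le_trans (le_of_eq ?_) hgμ'
            conv_rhs => rw [← hc.1]
            rw [Measure.fst, lintegral_map (f := fun x => edist x (g x)) (measurable_id.edist hgm)
              measurable_fst]
          · refine (lintegral_blockCoupling_comp_le hG h0 h1 h2 fun i j => edist i j).trans ?_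
            refine le_trans (le_of_eq ?_) (ENNReal.ofReal_le_ofReal h3)
            rw [ENNReal.ofReal_sum_of_nonneg fun a _ => mul_nonneg (h0 a) dist_nonneg]
            refine Finset.sum_congr rfl fun a _ => ?_
            rw [ENNReal.ofReal_mul (h0 a), edist_dist]
          · refine le_trans (le_of_eq ?_) hgν
            conv_rhs => rw [← hc.2]
            rw [Measure.snd, lintegral_map (f := fun x => edist (g x) x) (hgm.edist measurable_id)
              measurable_snd]
      _ = ENNReal.ofReal (b + 4 * ε) := by
          rw [← ENNReal.ofReal_add hε.le (by positivity), ← ENNReal.ofReal_add (by positivity) hε.le]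
          congr 1; ring
  have hlim : Filter.Tendsto (fun ε : ℝ => ENNReal.ofReal (b + 4 * ε)) (𝓝[>] 0)
      (𝓝 (ENNReal.ofReal (b + 4 * 0))) :=
    ((ENNReal.continuous_ofReal.comp (by fun_prop)).tendsto 0).mono_left nhdsWithin_le_nhds
  rw [mul_zero, add_zero] at hlim
  exact ge_of_tendsto hlim (by filter_upwards [self_mem_nhdsWithin] with ε hε using key ε hε)

end Duality

/-! ### Iterated kernels and laws of Markov chains -/

section Kernels

variable {Ω : Type*} [MeasurableSpace Ω]

theorem integral_bind_kernel {μ : Measure Ω} [IsProbabilityMeasure μ] {K : Kernel Ω Ω}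
    [IsMarkovKernel K] {f : Ω → ℝ} (hf : Measurable f) (hM : ∃ M, ∀ x, |f x| ≤ M) :
    ∫ x, f x ∂(μ.bind K) = ∫ x, ∫ y, f y ∂(K x) ∂μ := by
  rw [Measure.comp_eq_comp_const_apply, Kernel.integral_comp (integrable_of_abs_le hf hM),
    Kernel.const_apply]

theorem exists_abs_integral_kernel_le (K : Kernel Ω Ω) [IsMarkovKernel K] {f : Ω → ℝ} {M : ℝ}
    (hM : ∀ x, |f x| ≤ M) (x : Ω) : |∫ y, f y ∂(K x)| ≤ M := by
  have := norm_integral_le_of_norm_le_const (μ := K x) (f := f) (ae_of_all _ hM)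
  simpa using this

theorem measurable_integral_kernel (K : Kernel Ω Ω) {f : Ω → ℝ} (hf : Measurable f) :
    Measurable fun x => ∫ y, f y ∂(K x) :=
  hf.stronglyMeasurable.integral_kernel.measurable

/-- The `n`-step transition kernel. -/
noncomputable def stepKernel (K : Kernel Ω Ω) : ℕ → Kernel Ω Ω
  | 0 => Kernel.id
  | n + 1 => K ∘ₖ stepKernel K n

instance (K : Kernel Ω Ω) [IsMarkovKernel K] (n : ℕ) : IsMarkovKernel (stepKernel K n) := by
  induction n with
  | zero => unfold stepKernel; infer_instance
  | succ n ih => unfold stepKernel; infer_instance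

theorem stepKernel_succ_apply (K : Kernel Ω Ω) (n : ℕ) (x : Ω) :
    stepKernel K (n + 1) x = (stepKernel K n x).bind K := by
  rw [stepKernel, Kernel.comp_apply]

theorem bind_stepKernel_eq_of_invariant {K : Kernel Ω Ω} {π : Measure Ω}
    (h : Kernel.Invariant K π) (n : ℕ) : π.bind (stepKernel K n) = π := by
  induction n with
  | zero => rw [stepKernel, Measure.id_comp]
  | succ n ih => rw [stepKernel, ← Measure.comp_assoc, ih, h.def]

theorem past_le {S : Type*} [m : MeasurableSpace S] {X : ℕ → S → Ω} (hX : ∀ t, Measurable (X t))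
    (t : ℕ) : past X t ≤ m :=
  iSup_le fun s => (hX s).comap_le

/-- The law at time `t` of a Markov chain is the `t`-step transition probability. -/
theorem IsMarkovChain.map_eq {K : Kernel Ω Ω} [IsMarkovKernel K] {S : Type*} [MeasurableSpace S]
    {P : Measure S} [IsProbabilityMeasure P] {X : ℕ → S → Ω} {x : Ω}
    (h : IsMarkovChain K x P X) (t : ℕ) : P.map (X t) = stepKernel K t x := by
  induction t with
  | zero =>
    rw [stepKernel, Kernel.id_apply, Measure.map_congr (g := fun _ => x) h.initial,
      Measure.map_const, measure_univ, one_smul]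
  | succ t ih =>
    rw [stepKernel_succ_apply, ← ih]
    refine Measure.ext fun A hA => ?_
    rw [Measure.map_apply (h.measurable _) hA, Measure.bind_apply hA K.aemeasurable,
      lintegral_map (K.measurable_coe hA) (h.measurable t)]
    have hpre : MeasurableSet (X (t + 1) ⁻¹' A) := h.measurable _ hA
    have h1 : P.real (X (t + 1) ⁻¹' A) = ∫ ω, (K (X t ω)).real A ∂P := by
      rw [← integral_congr_ae (h.transition t A hA), integral_condExp (past_le h.measurable t)]
      rw [integral_indicator hpre]
      simp
    rw [← ofReal_measureReal, h1, ofReal_integral_eq_lintegral_ofReal]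
    · exact lintegral_congr fun ω => ofReal_measureReal
    · refine Integrable.of_bound (C := 1) ?_ (ae_of_all _ fun ω => ?_)
      · exact ((K.measurable_coe hA).comp (h.measurable t)).ennreal_toReal.aestronglyMeasurable
      · rw [Real.norm_of_nonneg measureReal_nonneg]
        exact measureReal_le_one
    · exact ae_of_all _ fun ω => measureReal_nonneg

end Kernels

/-! ### Perturbation of a contracting kernel -/

section Perturbation

variable {Ω : Type*} [MetricSpace Ω] [MeasurableSpace Ω] [BorelSpace Ω]
  {K K' : Kernel Ω Ω} [IsMarkovKernel K] [IsMarkovKernel K'] {π : Measure Ω}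
  [IsProbabilityMeasure π] {β δ : ℝ}

/-- One step of a perturbed contracting chain. -/
theorem LipschitzClose.bind (hβ : 0 ≤ β)
    (hK : ∀ x y, LipschitzClose (K x) (K y) (β * dist x y))
    (hK' : ∀ x, LipschitzClose (K' x) (K x) δ) {μ ν : Measure Ω} [IsProbabilityMeasure μ]
    [IsProbabilityMeasure ν] {b : ℝ} (h : LipschitzClose μ ν b) :
    LipschitzClose (μ.bind K') (ν.bind K) (β * b + δ) := by
  intro c f hf hM
  have hfm := hf.continuous.measurable
  rw [integral_bind_kernel hfm hM, integral_bind_kernel hfm hM]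
  obtain ⟨M, hM⟩ := hM
  have iK : ∀ (L : Kernel Ω Ω) [IsMarkovKernel L],
      Integrable (fun x => ∫ y, f y ∂(L x)) μ := fun L _ =>
    integrable_of_abs_le (measurable_integral_kernel L hfm)
      ⟨M, exists_abs_integral_kernel_le L hM⟩
  have h1 : ∫ x, ∫ y, f y ∂(K' x) ∂μ ≤ ∫ x, ∫ y, f y ∂(K x) ∂μ + c * δ := by
    calc ∫ x, ∫ y, f y ∂(K' x) ∂μ ≤ ∫ x, (∫ y, f y ∂(K x) + c * δ) ∂μ :=
          integral_mono (iK K') ((iK K).add (integrable_const _)) fun x => hK' x c f hf ⟨M, hM⟩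
      _ = _ := by rw [integral_add (iK K) (integrable_const _)]; simp
  have hL : LipschitzWith (c * β.toNNReal) fun x => ∫ y, f y ∂(K x) := by
    refine LipschitzWith.of_le_add_mul _ fun x y => ?_
    have := hK x y c f hf ⟨M, hM⟩
    rw [NNReal.coe_mul, Real.coe_toNNReal β hβ, mul_assoc]
    exact this
  have h2 := h _ _ hL ⟨M, exists_abs_integral_kernel_le K hM⟩
  rw [NNReal.coe_mul, Real.coe_toNNReal β hβ] at h2
  linarith

variable [SecondCountableTopology Ω]

theorem lipschitzClose_dirac {x : Ω} (hx : eccentricity π x ≠ ∞) :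
    LipschitzClose (Measure.dirac x) π (eccentricity π x).toReal := by
  refine .of_coupling (ζ := (Measure.dirac x).prod π) ⟨by simp, by simp⟩
    ENNReal.toReal_nonneg ?_
  rw [ENNReal.ofReal_toReal hx, lintegral_prod _ measurable_edist.aemeasurable,
    lintegral_dirac' _ measurable_edist.lintegral_prod_right', eccentricity]

/-- The constant `δ / (1 - β)` is the fixed point of `b ↦ β * b + δ`, and the deviation from it
shrinks by `β` at each step. -/
theorem lipschitzClose_stepKernel (hβ : 0 ≤ β) (hβ1 : β < 1) (hδ : 0 ≤ δ)
    (hK : ∀ x y, LipschitzClose (K x) (K y) (β * dist x y))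
    (hK' : ∀ x, LipschitzClose (K' x) (K x) δ) (hπ : Kernel.Invariant K π) {x : Ω}
    (hx : eccentricity π x ≠ ∞) (n : ℕ) :
    LipschitzClose (stepKernel K' n x) π (δ / (1 - β) + β ^ n * (eccentricity π x).toReal) := by
  have h1 : 0 < 1 - β := by linarith
  induction n with
  | zero =>
    intro c f hf hM
    rw [stepKernel, Kernel.id_apply]
    have h2 := lipschitzClose_dirac hx c f hf hM
    have h3 : 0 ≤ (c : ℝ) * (δ / (1 - β)) := by positivity
    rw [pow_zero, one_mul, mul_add]
    linarith
  | succ n ih =>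
    have := ih.bind hβ hK hK'
    rw [hπ.def, ← stepKernel_succ_apply] at this
    convert this using 1
    field_simp
    ring

/-- The eccentricity is not known to be `π'`-integrable, so the `n`-step bound cannot be integrated
directly. For a test bounded by `M` it can be cut off at `M`, and dominated convergence applies. -/
theorem lipschitzClose_of_invariant (hβ : 0 ≤ β) (hβ1 : β < 1) (hδ : 0 ≤ δ)
    (hK : ∀ x y, LipschitzClose (K x) (K y) (β * dist x y))
    (hK' : ∀ x, LipschitzClose (K' x) (K x) δ) (hπ : Kernel.Invariant K π)
    (hE : ∀ x, eccentricity π x ≠ ∞) {π' : Measure Ω} [IsProbabilityMeasure π']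
    (hπ' : Kernel.Invariant K' π') : LipschitzClose π' π (δ / (1 - β)) := by
  intro c f hf ⟨M, hM⟩
  have h1 : 0 < 1 - β := by linarith
  have hfm := hf.continuous.measurable
  have hEm : Measurable (eccentricity π) := measurable_edist.lintegral_prod_right'
  have hfπ : -M ≤ ∫ x, f x ∂π := by
    have := norm_integral_le_of_norm_le_const (μ := π) (f := f) (ae_of_all _ hM)
    rw [probReal_univ, mul_one] at this
    exact (abs_le.1 this).1
  let a : ℝ := ∫ x, f x ∂π + c * (δ / (1 - β))
  let g : ℕ → Ω → ℝ := fun n x => min M (a + c * (β ^ n * (eccentricity π x).toReal))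
  have hgm : ∀ n, Measurable (g n) := fun n =>
    measurable_const.min (((hEm.ennreal_toReal.const_mul _).const_mul _).const_add _)
  have hgM : ∀ n x, |g n x| ≤ M := by
    intro n x
    refine abs_le.2 ⟨le_min ?_ ?_, min_le_left _ _⟩
    · linarith [(abs_nonneg _).trans (hM x)]
    · have h2 : 0 ≤ (c : ℝ) * (δ / (1 - β)) := by positivity
      have h3 : 0 ≤ (c : ℝ) * (β ^ n * (eccentricity π x).toReal) := by positivity
      simp only [a]
      linarith
  have hle : ∀ n, ∫ x, f x ∂π' ≤ ∫ x, g n x ∂π' := by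
    intro n
    conv_lhs => rw [← bind_stepKernel_eq_of_invariant hπ' n]
    rw [integral_bind_kernel hfm ⟨M, hM⟩]
    refine integral_mono (integrable_of_abs_le (measurable_integral_kernel _ hfm)
      ⟨M, exists_abs_integral_kernel_le _ hM⟩) (integrable_of_abs_le (hgm n) ⟨M, hgM n⟩)
      fun x => le_min ?_ ?_
    · exact (abs_le.1 (exists_abs_integral_kernel_le (stepKernel K' n) hM x)).2
    · have := lipschitzClose_stepKernel hβ hβ1 hδ hK hK' hπ (hE x) n c f hf ⟨M, hM⟩
      simp only [a]
      linarith
  have hlim : Filter.Tendsto (fun n => ∫ x, g n x ∂π') Filter.atTop (𝓝 (∫ _, min M a ∂π')) := by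
    refine tendsto_integral_of_dominated_convergence (fun _ => M)
      (fun n => (hgm n).aestronglyMeasurable) (integrable_const _)
      (fun n => ae_of_all _ (hgM n)) (ae_of_all _ fun x => ?_)
    have hp := tendsto_pow_atTop_nhds_zero_of_lt_one hβ hβ1
    have := tendsto_const_nhds (x := M) |>.min
      (((hp.mul_const (eccentricity π x).toReal).const_mul (c : ℝ)).const_add a)
    simpa using this
  have := ge_of_tendsto' hlim hle
  rw [integral_const, probReal_univ, one_smul] at this
  exact this.trans (min_le_right _ _)

end Perturbation

end MarkovPerturbation

open MarkovPerturbation in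
theorem mainTheorem5 {Ω : Type*} [MetricSpace Ω] [PolishSpace Ω] [MeasurableSpace Ω]
    [BorelSpace Ω]
    (K K' : Kernel Ω Ω) [IsMarkovKernel K] [IsMarkovKernel K']
    (π : Measure Ω) [IsProbabilityMeasure π] (hπ : Kernel.Invariant K π)
    (hE : ∀ x : Ω, MarkovPerturbation.eccentricity π x < ∞)
    (α δ : ℝ) (hα : 0 < α) (hα1 : α ≤ 1) (hδ : 0 < δ)
    (hcontr : (⨆ (x : Ω) (y : Ω) (_ : x ≠ y),
      MarkovPerturbation.wasserstein (K x) (K y) / edist x y) ≤ ENNReal.ofReal (1 - α))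
    (hclose : (⨆ x : Ω, MarkovPerturbation.wasserstein (K' x) (K x)) < ENNReal.ofReal δ) :
    (∀ (x : Ω) {S : Type*} [MeasurableSpace S] (P : Measure S) [IsProbabilityMeasure P]
        (X : ℕ → S → Ω), MarkovPerturbation.IsMarkovChain K' x P X → ∀ T : ℕ,
        MarkovPerturbation.wasserstein (P.map (X T)) π ≤
          ENNReal.ofReal (δ / α) +
            ENNReal.ofReal ((1 - α) ^ T) * MarkovPerturbation.eccentricity π x) ∧
      (∀ (π' : Measure Ω) [IsProbabilityMeasure π'], Kernel.Invariant K' π' →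
        MarkovPerturbation.wasserstein π' π ≤ ENNReal.ofReal (δ / α)) := by
  have hβ : 0 ≤ 1 - α := by linarith
  have hβ1 : 1 - α < 1 := by linarith
  have hK' : ∀ x, LipschitzClose (K' x) (K x) δ := fun x =>
    .of_wasserstein_le hδ.le ((le_iSup (fun x => wasserstein (K' x) (K x)) x).trans hclose.le)
  have hK : ∀ x y, LipschitzClose (K x) (K y) ((1 - α) * dist x y) := by
    intro x y
    -- The supremum in `hcontr` omits the diagonal, where closeness is trivial.
    rcases eq_or_ne x y with rfl | hxy
    · intro c f _ _
      simp
    refine .of_wasserstein_le (by positivity) ?_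
    have h1 : wasserstein (K x) (K y) / edist x y ≤ ENNReal.ofReal (1 - α) :=
      iSup_le_iff.1 (iSup_le_iff.1 (iSup_le_iff.1 hcontr x) y) hxy
    rw [ENNReal.div_le_iff (edist_pos.2 hxy).ne' (edist_ne_top _ _)] at h1
    rwa [ENNReal.ofReal_mul hβ, ← edist_dist]
  have hE' : ∀ x, eccentricity π x ≠ ∞ := fun x => (hE x).ne
  refine ⟨fun x S _ P _ X hX T => ?_, fun π' _ hπ' => ?_⟩
  · rw [hX.map_eq]
    have h := lipschitzClose_stepKernel hβ hβ1 hδ.le hK hK' hπ (hE' x) T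
    rw [sub_sub_cancel] at h
    refine (h.wasserstein_le (hE' x) (by positivity)).trans (le_of_eq ?_)
    rw [ENNReal.ofReal_add (by positivity) (by positivity), ENNReal.ofReal_mul (by positivity),
      ENNReal.ofReal_toReal (hE' x)]
  · have h := lipschitzClose_of_invariant hβ hβ1 hδ.le hK hK' hπ hE' hπ'
    rw [sub_sub_cancel] at h
    obtain ⟨x⟩ : Nonempty Ω := π.nonempty_of_neZero
    exact h.wasserstein_le (hE' x) (by positivity)
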